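/- For $r\in(0,1)$ let $\tilde\gamma(r)=\min_{t\in(0,\pi)}\frac{t^r}{\sin t}$ (the minimum is attained). Let $A,B,X$ be bounded linear operators on a complex Hilbert space $\mathcal H$, with $A,B\ge 0$, and let $\|\cdot\|$ be the operator norm. Then for every $r\in(0,1)$, \[ \|A^rX-XB^r\|\le\tilde\gamma(r)\,\|X\|^{1-r}\,\|AX-XB\|^r . \] Consequently, let $\gamma_0(r)$ be the optimal constant in the commutator inequality, that is, the least $C\ge 0$ such that $\|A^rX-XA^r\|\le C\|X\|^{1-r}\|AX-XA\|^r$ for all bounded operators $A\ge0$ and $X$ on all complex Hilbert spaces. This least constant exists, $\gamma_0(r)\le\tilde\gamma(r)$ for all $r\in(0,1)$, and in particular $\gamma_0(1/2)\le 1.1748$. -/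

import Mathlib

universe u

/-- The set of values `t ^ r / sin t` for `t` in the open interval `(0, π)`. -/
def sinRatioValues (r : ℝ) : Set ℝ :=
  (fun t : ℝ => t ^ r / Real.sin t) '' Set.Ioo 0 Real.pi

/-- `γ̃(r)`, the minimum of `t ^ r / sin t` over `t ∈ (0, π)`, defined as an infimum
(the theorem asserts that it is attained). -/
noncomputable def gammaTilde (r : ℝ) : ℝ := sInf (sinRatioValues r)

/-- The constants `C ≥ 0` such that `‖A^r X - X A^r‖ ≤ C ‖X‖^(1-r) ‖A X - X A‖^r` for all bounded
operators `A ≥ 0` and `X` on all complex Hilbert spaces. -/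
def commutatorConstants (r : ℝ) : Set ℝ :=
  {C : ℝ | 0 ≤ C ∧
    ∀ (H : Type u) [NormedAddCommGroup H] [InnerProductSpace ℂ H] [CompleteSpace H]
      (A X : H →L[ℂ] H), 0 ≤ A →
        ‖A ^ r * X - X * A ^ r‖ ≤ C * ‖X‖ ^ (1 - r) * ‖A * X - X * A‖ ^ r}

/-- `γ₀(r)`, the optimal constant in the commutator inequality, defined as an infimum
(the theorem asserts that it is attained). -/
noncomputable def gammaZero (r : ℝ) : ℝ := sInf (commutatorConstants.{u} r)

/-! Write `[p, q] = p * q - q * p`. For skew-adjoint `y` with `‖y‖ ≤ 1`, `0 < t < π` and the unitary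
`u = exp (t • y)`, the estimate is a chain: `‖[y, a^r]‖ ≤ ‖[u, a^r]‖ / sin t ≤ ‖[u, a]‖^r / sin t ≤
(t * ‖[y, a]‖)^r / sin t`. The middle link is operator monotonicity of powers
(`norm_unitary_commutator_rpow_le`), the last a mean value inequality (`norm_exp_commutator_le`).

The first link, `norm_skew_commutator_le_sin`, is a Bernstein-type inequality. The orbit `s ↦ exp (s
• y) * K * exp (-s • y)` has frequencies in `[-2, 2]`, so its derivative at `0` is a series of
differences of the orbit over steps of length `t`, weighted by the Fourier coefficients of `x / sin
(t * x)` on `[-1, 1]`. That function is even, convex and nonnegative, so its coefficients alternate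
in sign and their absolute sum is its value `1 / sin t` at `x = 1`.

Taking `y = i x / ‖x‖` settles self-adjoint `x`; a 2 × 2 block matrix reduces two operators `A`, `B`
and arbitrary `X` to that case. It remains to minimise over `t`. -/

open scoped NNReal Topology
open Filter

/-! ### Powers of positive elements and unitary commutators. -/

section Rpow
variable {A : Type*} [CStarAlgebra A] [PartialOrder A] [StarOrderedRing A]

theorem rpow_add_algebraMap_le {r : ℝ} (hr : r ∈ Set.Ioo (0 : ℝ) 1) {a : A} (ha : 0 ≤ a) (δ : ℝ≥0) :
    (a + algebraMap ℝ≥0 A δ) ^ r ≤ a ^ r + algebraMap ℝ≥0 A (δ ^ r) := by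
  have hc : Continuous fun x : ℝ≥0 => x ^ r := NNReal.continuous_rpow_const hr.1.le
  have h1 : a + algebraMap ℝ≥0 A δ = cfc (fun x : ℝ≥0 => x + δ) a := by
    rw [cfc_add_const δ (fun x : ℝ≥0 => x) a, cfc_id' ℝ≥0 a]
  rw [h1, CFC.rpow_def, CFC.rpow_def,
    ← cfc_comp' (fun x : ℝ≥0 => x ^ r) (fun x : ℝ≥0 => x + δ) a hc.continuousOn,
    ← cfc_add_const (δ ^ r) (fun x : ℝ≥0 => x ^ r) a hc.continuousOn]
  refine cfc_mono (fun x _ => NNReal.rpow_add_le_add_rpow x δ hr.1.le hr.2.le) ?_ ?_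
  · exact (hc.comp (continuous_id.add continuous_const)).continuousOn
  · exact (hc.add continuous_const).continuousOn

/-- With `δ = ‖a - b‖`, operator monotonicity applied to `a ≤ b + δ` gives `a^r ≤ (b + δ)^r ≤ b^r +
δ^r`. -/
theorem rpow_sub_rpow_le {r : ℝ} (hr : r ∈ Set.Ioo (0 : ℝ) 1) {a b : A} (ha : 0 ≤ a) (hb : 0 ≤ b) :
    a ^ r - b ^ r ≤ algebraMap ℝ A (‖a - b‖ ^ r) := by
  have h0 : IsSelfAdjoint (a - b) := ha.isSelfAdjoint.sub hb.isSelfAdjoint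
  have h1 : a ≤ b + algebraMap ℝ≥0 A ‖a - b‖₊ := by
    have := h0.le_algebraMap_norm_self
    rw [sub_le_iff_le_add'] at this
    exact this
  have h2 := (CFC.rpow_le_rpow ⟨hr.1.le, hr.2.le⟩ h1).trans (rpow_add_algebraMap_le hr hb _)
  rw [sub_le_iff_le_add']
  exact h2

theorem norm_rpow_sub_rpow_le {r : ℝ} (hr : r ∈ Set.Ioo (0 : ℝ) 1) {a b : A} (ha : 0 ≤ a)
    (hb : 0 ≤ b) : ‖a ^ r - b ^ r‖ ≤ ‖a - b‖ ^ r := by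
  have h0 : IsSelfAdjoint (a ^ r - b ^ r) :=
    CFC.rpow_nonneg.isSelfAdjoint.sub CFC.rpow_nonneg.isSelfAdjoint
  have h1 := rpow_sub_rpow_le hr ha hb
  have h2 := rpow_sub_rpow_le hr hb ha
  rw [norm_sub_rev] at h2
  have hδ : 0 ≤ ‖a - b‖ ^ r := by positivity
  rw [le_algebraMap_iff_spectrum_le] at h1
  rw [← neg_sub, neg_le, ← map_neg, algebraMap_le_iff_le_spectrum] at h2
  rw [← cfc_id' ℝ (a ^ r - b ^ r)]
  exact norm_cfc_le hδ fun x hx => abs_le.2 ⟨h2 x hx, h1 x hx⟩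

theorem rpow_unitary_conj {r : ℝ} (hr : 0 < r) {a : A} (ha : 0 ≤ a) (u : unitary A) :
    ((u : A) * a * star (u : A)) ^ r = u * a ^ r * star (u : A) := by
  have hc : Continuous fun x : ℝ≥0 => x ^ r := NNReal.continuous_rpow_const hr.le
  have := StarAlgHomClass.map_cfc (S := ℝ) (Unitary.conjStarAlgAut ℝ A u) (fun x : ℝ≥0 => x ^ r) a
    hc.continuousOn
    (show Continuous fun x : A => (u : A) * x * star (u : A) by fun_prop) ha
    (by simpa only [Unitary.conjStarAlgAut_apply] using star_right_conjugate_nonneg ha _)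
  simp only [Unitary.conjStarAlgAut_apply] at this
  rw [CFC.rpow_def, CFC.rpow_def, this]

/-- A commutator with `u` has the norm of `u * b * star u - b`, and conjugation by `u` commutes with
powers, so the Hölder bound for differences applies. -/
theorem norm_unitary_commutator_rpow_le {r : ℝ} (hr : r ∈ Set.Ioo (0 : ℝ) 1) {a u : A} (ha : 0 ≤ a)
    (hu : u ∈ unitary A) : ‖u * a ^ r - a ^ r * u‖ ≤ ‖u * a - a * u‖ ^ r := by
  have key : ∀ b : A, ‖u * b - b * u‖ = ‖u * b * star u - b‖ := fun b => by
    have : u * b - b * u = (u * b * star u - b) * u := by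
      rw [sub_mul, mul_assoc _ (star u), Unitary.star_mul_self_of_mem hu, mul_one]
    rw [this, CStarRing.norm_mul_mem_unitary _ hu]
  rw [key, key, ← rpow_unitary_conj hr.1 ha ⟨u, hu⟩]
  exact norm_rpow_sub_rpow_le hr (star_right_conjugate_nonneg ha _) ha

end Rpow

/-! ### One-parameter unitary groups and their commutators. -/

section Exp
open NormedSpace
variable {A : Type*} [CStarAlgebra A]

theorem exp_smul_mem_unitary {y : A} (hy : y ∈ skewAdjoint A) (s : ℝ) : exp (s • y) ∈ unitary A := by
  let +nondep : NormedAlgebra ℚ A := .restrictScalars ℚ ℂ A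
  exact exp_mem_unitary_of_mem_skewAdjoint (skewAdjoint.smul_mem s hy)

theorem norm_exp_smul_le_one {y : A} (hy : y ∈ skewAdjoint A) (s : ℝ) : ‖exp (s • y)‖ ≤ 1 := by
  nontriviality A
  exact (CStarRing.norm_of_mem_unitary (exp_smul_mem_unitary hy s)).le

/-- Conjugation of `K` by the one-parameter group generated by `y`. -/
noncomputable def expConj (y K : A) (s : ℝ) : A := exp (s • y) * K * exp (-s • y)

theorem hasDerivAt_expConj (y K : A) (s : ℝ) :
    HasDerivAt (expConj y K) (exp (s • y) * (y * K - K * y) * exp (-s • y)) s := by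
  have h1 := hasDerivAt_exp_smul_const (𝕂 := ℝ) y s
  have h2 := (hasDerivAt_exp_smul_const' (𝕂 := ℝ) y (-s)).scomp s (hasDerivAt_neg s)
  convert! (h1.mul_const K).mul h2 using 1
  simp only [Function.comp_def]
  simp only [mul_sub, sub_mul, mul_assoc, neg_smul, one_smul, mul_neg, ← sub_eq_add_neg]

theorem exp_smul_mul_exp_neg_smul (y : A) (s : ℝ) : exp (s • y) * exp (-s • y) = 1 := by
  let +nondep : NormedAlgebra ℚ A := .restrictScalars ℚ ℂ A
  rw [← exp_add_of_commute]
  · simp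
  · exact ((Commute.refl y).smul_left _).smul_right _

/-- Up to a unitary factor the left side is the increment of `expConj y K` over `[0, s]`, and the
derivative of that curve has constant norm `‖y * K - K * y‖`. -/
theorem norm_exp_commutator_le {y : A} (hy : y ∈ skewAdjoint A) (K : A) {s : ℝ} (hs : 0 ≤ s) :
    ‖exp (s • y) * K - K * exp (s • y)‖ ≤ s * ‖y * K - K * y‖ := by
  have h1 : exp (s • y) * K - K * exp (s • y) = (expConj y K s - expConj y K 0) * exp (s • y) := by
    have := exp_smul_mul_exp_neg_smul y (-s)
    rw [neg_neg] at this
    rw [expConj, expConj, sub_mul, mul_assoc _ _ (exp (s • y)), this]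
    simp
  rw [h1, CStarRing.norm_mul_mem_unitary _ (exp_smul_mem_unitary hy s)]
  have h2 := convex_univ.norm_image_sub_le_of_norm_hasDerivWithin_le
    (f := expConj y K) (x := 0) (y := s) (C := ‖y * K - K * y‖)
    (fun x _ => (hasDerivAt_expConj y K x).hasDerivWithinAt) (fun x _ => ?_) trivial trivial
  · simpa [abs_of_nonneg hs, mul_comm] using h2
  · rw [CStarRing.norm_mul_mem_unitary _ (exp_smul_mem_unitary hy _),
      CStarRing.norm_mem_unitary_mul _ (exp_smul_mem_unitary hy _)]

end Exp

/-! ### Operator-valued trigonometric polynomials and derivative interpolation. -/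

section TrigPoly
open NormedSpace
variable {A : Type*} [CStarAlgebra A]

/-- Operator-valued trigonometric polynomials with frequencies in `[-σ, σ]`. -/
noncomputable def trigPoly (A : Type*) [CStarAlgebra A] (σ : ℝ) : Submodule ℂ (ℝ → A) :=
  Submodule.span ℂ {F | ∃ (d : ℝ) (Z : A), |d| ≤ σ ∧ 
    F = fun s : ℝ => Complex.exp (d * s * Complex.I) • Z}

theorem exp_smul_mem_trigPoly {d σ : ℝ} (hd : |d| ≤ σ) (Z : A) :
    (fun s : ℝ => Complex.exp (d * s * Complex.I) • Z) ∈ trigPoly A σ :=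
  Submodule.subset_span ⟨d, Z, hd, rfl⟩

theorem const_mem_trigPoly (K : A) : (fun _ : ℝ => K) ∈ trigPoly A 0 := by
  simpa using exp_smul_mem_trigPoly (d := 0) (σ := 0) (by simp) K

theorem mul_mem_trigPoly {σ τ : ℝ} {F G : ℝ → A} (hF : F ∈ trigPoly A σ) (hG : G ∈ trigPoly A τ) :
    F * G ∈ trigPoly A (σ + τ) := by
  have h := Submodule.mul_mem_mul hF hG
  rw [trigPoly, trigPoly, Submodule.span_mul_span] at h
  refine Submodule.span_mono (Set.mul_subset_iff.2 ?_) h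
  rintro _ ⟨d, Z, hd, rfl⟩ _ ⟨e, W, he, rfl⟩
  refine ⟨d + e, Z * W, (abs_add_le d e).trans (add_le_add hd he), ?_⟩
  funext s
  rw [Pi.mul_apply, smul_mul_smul_comm, ← Complex.exp_add]
  congr 2
  push_cast
  ring

theorem pow_mem_trigPoly {σ : ℝ} {F : ℝ → A} (hF : F ∈ trigPoly A σ) (n : ℕ) :
    F ^ n ∈ trigPoly A (n * σ) := by
  induction n with
  | zero =>
    rw [pow_zero, Nat.cast_zero, zero_mul]
    exact const_mem_trigPoly (1 : A)
  | succ n ih =>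
    rw [pow_succ, Nat.cast_succ, add_one_mul]
    exact mul_mem_trigPoly ih hF

/-- An interpolation formula for the derivative that is exact on the exponentials with frequency
in `[-σ, σ]` is exact on trigonometric polynomials with these frequencies. -/
theorem exists_hasDerivAt_hasSum_of_mem_trigPoly {σ τ : ℝ} {c : ℤ → ℂ} {l : ℤ → ℝ}
    (h : ∀ d : ℝ, |d| ≤ σ → HasSum (fun k => c k * (Complex.exp (d * (l k + τ : ℝ) * Complex.I) -
      Complex.exp (d * (l k - τ : ℝ) * Complex.I))) (d * Complex.I))
    {F : ℝ → A} (hF : F ∈ trigPoly A σ) :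
    ∃ F' : A, HasDerivAt F F' 0 ∧ HasSum (fun k => c k • (F (l k + τ) - F (l k - τ))) F' := by
  induction hF using Submodule.span_induction with
  | mem F hF =>
    obtain ⟨d, Z, hd, rfl⟩ := hF
    refine ⟨((d : ℂ) * Complex.I) • Z, ?_, ?_⟩
    · have h1 : HasDerivAt (fun s : ℝ => Complex.exp (d * s * Complex.I)) (d * Complex.I) 0 := by
        have := (((Complex.ofRealCLM.hasDerivAt (x := (0 : ℝ))).const_mul (d : ℂ)).mul_const
          Complex.I).cexp
        simpa using this
      exact h1.smul_const Z
    · convert (h d hd).smul_const Z using 2 with k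
      rw [mul_smul, sub_smul]
  | zero => exact ⟨0, hasDerivAt_const _ _, by simp⟩
  | add F G _ _ hF hG =>
    obtain ⟨F', h1, h2⟩ := hF
    obtain ⟨G', h3, h4⟩ := hG
    refine ⟨F' + G', h1.add h3, ?_⟩
    convert h2.add h4 using 2 with k
    simp only [Pi.add_apply, ← smul_add]
    congr 1
    abel
  | smul a F _ hF =>
    obtain ⟨F', h1, h2⟩ := hF
    refine ⟨a • F', h1.const_smul a, ?_⟩
    convert h2.const_smul a using 2 with k
    simp only [Pi.smul_apply, ← smul_sub, smul_comm a]

end TrigPoly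

/-! ### Band-limited approximation of the conjugation orbit. -/

section Approx
open NormedSpace
variable {A : Type*} [CStarAlgebra A]

/-- The first-order trigonometric approximation `cos h + sin h • y` of `exp (h • y)`. -/
noncomputable def cosAddSin (y : A) (h : ℝ) : A := Real.cos h • (1 : A) + Real.sin h • y

theorem norm_one_le_one : ‖(1 : A)‖ ≤ 1 := by
  nontriviality A
  exact norm_one.le

/-- Since `star y = -y`, the cross terms cancel in `star c * c`, leaving `cos² + sin² • (star y *
y)`, of norm at most `1`. -/
theorem norm_cosAddSin_le_one {y : A} (hy : y ∈ skewAdjoint A) (hy1 : ‖y‖ ≤ 1) (h : ℝ) :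
    ‖cosAddSin y h‖ ≤ 1 := by
  have h1 : star (cosAddSin y h) * cosAddSin y h =
      (Real.cos h ^ 2) • (1 : A) + (Real.sin h ^ 2) • (star y * y) := by
    rw [cosAddSin, star_add, star_smul, star_smul, skewAdjoint.mem_iff.1 hy]
    simp only [star_one, star_trivial, add_mul, mul_add, smul_mul_smul_comm, one_mul, mul_one,
      neg_mul, smul_neg, ← sq (Real.cos h), ← sq (Real.sin h), mul_comm (Real.sin h) (Real.cos h)]
    abel
  have h2 : ‖cosAddSin y h‖ * ‖cosAddSin y h‖ ≤ 1 := by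
    rw [← CStarRing.norm_star_mul_self, h1]
    refine (norm_add_le _ _).trans ?_
    rw [norm_smul, norm_smul, CStarRing.norm_star_mul_self, Real.norm_of_nonneg (sq_nonneg _),
      Real.norm_of_nonneg (sq_nonneg _)]
    have h3 : ‖y‖ * ‖y‖ ≤ 1 := mul_le_one₀ hy1 (norm_nonneg _) hy1
    have h4 := norm_one_le_one (A := A)
    nlinarith [Real.sin_sq_add_cos_sq h, sq_nonneg (Real.sin h), sq_nonneg (Real.cos h)]
  nlinarith [norm_nonneg (cosAddSin y h)]

theorem norm_pow_sub_pow_le {a b : A} (ha : ‖a‖ ≤ 1) (hb : ‖b‖ ≤ 1) (n : ℕ) :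
    ‖a ^ n - b ^ n‖ ≤ n * ‖a - b‖ := by
  have hpow : ∀ m : ℕ, ‖b ^ m‖ ≤ 1 := fun m => by
    induction m with
    | zero => simpa using norm_one_le_one
    | succ m ih =>
      rw [pow_succ]
      exact (norm_mul_le _ _).trans (mul_le_one₀ ih (norm_nonneg _) hb)
  induction n with
  | zero => simp
  | succ n ih =>
    have : a ^ (n + 1) - b ^ (n + 1) = a * (a ^ n - b ^ n) + (a - b) * b ^ n := by
      rw [pow_succ', pow_succ']; noncomm_ring
    rw [this]
    refine (norm_add_le _ _).trans ?_
    have h1 := (norm_mul_le a (a ^ n - b ^ n)).trans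
      (mul_le_of_le_one_left (norm_nonneg _) ha)
    have h2 := (norm_mul_le (a - b) (b ^ n)).trans
      (mul_le_of_le_one_right (norm_nonneg _) (hpow n))
    push_cast
    linarith

theorem hasDerivAt_cosAddSin_zero (y : A) : HasDerivAt (cosAddSin y) y 0 := by
  have := ((Real.hasDerivAt_cos 0).smul_const (1 : A)).fun_add ((Real.hasDerivAt_sin 0).smul_const y)
  simp only [Real.sin_zero, neg_zero, zero_smul, Real.cos_zero, one_smul, zero_add] at this
  exact this

/-- Both `cosAddSin y h` and `exp (h • y)` are contractions that agree to first order, so their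
`n`-th powers at `h = s / n` differ by at most `n * o(1 / n)`. -/
theorem tendsto_cosAddSin_pow {y : A} (hy : y ∈ skewAdjoint A) (hy1 : ‖y‖ ≤ 1) (s : ℝ) :
    Tendsto (fun n : ℕ => cosAddSin y (s / n) ^ n) atTop (𝓝 (exp (s • y))) := by
  let +nondep : NormedAlgebra ℚ A := .restrictScalars ℚ ℂ A
  have h1 : HasDerivAt (fun h : ℝ => cosAddSin y h - exp (h • y)) 0 0 := by
    have := (hasDerivAt_cosAddSin_zero y).fun_sub (hasDerivAt_exp_smul_const (𝕂 := ℝ) y 0)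
    simpa using this
  have h2 : Tendsto (fun n : ℕ => s / (n : ℝ)) atTop (𝓝 0) :=
    tendsto_const_div_atTop_nhds_zero_nat s
  have h3 : (fun h : ℝ => cosAddSin y h - exp (h • y)) =o[𝓝 0] fun h : ℝ => h := by
    have := h1.isLittleO
    simpa [cosAddSin] using this
  have h4 : Tendsto (fun n : ℕ => (n : ℝ) *
      ‖cosAddSin y (s / n) - exp ((s / n : ℝ) • y)‖) atTop (𝓝 0) := by
    have h5 := (h3.comp_tendsto h2).norm_left
    have h6 : (fun n : ℕ => (n : ℝ) * ‖cosAddSin y (s / n) - exp ((s / n : ℝ) • y)‖)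
        =o[atTop] fun _ : ℕ => (1 : ℝ) := by
      refine ((Asymptotics.isBigO_refl (fun n : ℕ => (n : ℝ)) atTop).mul_isLittleO h5).trans_isBigO
        (Asymptotics.IsBigO.of_bound |s| (Eventually.of_forall fun n => ?_))
      rcases eq_or_ne (n : ℝ) 0 with hn | hn
      · simp [hn]
      · simp [mul_div_cancel₀ s hn]
    exact (Asymptotics.isLittleO_one_iff ℝ).1 h6
  rw [tendsto_iff_norm_sub_tendsto_zero]
  refine squeeze_zero' (Eventually.of_forall fun _ => norm_nonneg _) ?_ h4
  filter_upwards [eventually_ne_atTop 0] with n hn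
  have h7 : exp (s • y) = exp ((s / n : ℝ) • y) ^ n := by
    rw [← exp_nsmul, ← Nat.cast_smul_eq_nsmul ℝ, smul_smul,
      mul_div_cancel₀ s (Nat.cast_ne_zero.2 hn)]
  rw [h7]
  exact norm_pow_sub_pow_le (norm_cosAddSin_le_one hy hy1 _) (norm_exp_smul_le_one hy _) n

theorem cosAddSin_mem_trigPoly (y : A) (a : ℝ) :
    (fun s => cosAddSin y (a * s)) ∈ trigPoly A |a| := by
  have h1 := exp_smul_mem_trigPoly (d := a) le_rfl ((2⁻¹ : ℂ) • (1 - Complex.I • y))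
  have h2 := exp_smul_mem_trigPoly (d := -a) (abs_neg a).le ((2⁻¹ : ℂ) • (1 + Complex.I • y))
  convert (trigPoly A |a|).add_mem h1 h2 using 1
  ext s
  have hE : ∀ x : ℝ, cosAddSin y x = Complex.cos x • (1 : A) + Complex.sin x • y := fun x => by
    rw [cosAddSin, ← Complex.ofReal_cos, ← Complex.ofReal_sin, Complex.coe_smul, Complex.coe_smul]
  rw [hE, Complex.cos, Complex.sin]
  simp only [Pi.add_apply, smul_add, smul_sub, smul_smul]
  push_cast
  match_scalars <;> ring_nf

/-- Trigonometric polynomials approximating the conjugation of `K` by `exp (s • y)`. -/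
noncomputable def conjApprox (y K : A) (n : ℕ) (s : ℝ) : A :=
  cosAddSin y (s / n) ^ n * K * cosAddSin y (-s / n) ^ n

theorem tendsto_conjApprox {y : A} (hy : y ∈ skewAdjoint A) (hy1 : ‖y‖ ≤ 1) (K : A) (s : ℝ) :
    Tendsto (fun n => conjApprox y K n s) atTop (𝓝 (expConj y K s)) :=
  ((tendsto_cosAddSin_pow hy hy1 s).mul_const K).mul (tendsto_cosAddSin_pow hy hy1 (-s))

theorem norm_conjApprox_le {y : A} (hy : y ∈ skewAdjoint A) (hy1 : ‖y‖ ≤ 1) (K : A) (n : ℕ)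
    (s : ℝ) : ‖conjApprox y K n s‖ ≤ ‖K‖ := by
  have hpow : ∀ h : ℝ, ∀ m : ℕ, ‖cosAddSin y h ^ m‖ ≤ 1 := fun h m => by
    induction m with
    | zero => simpa using norm_one_le_one
    | succ m ih =>
      rw [pow_succ]
      exact (norm_mul_le _ _).trans
        (mul_le_one₀ ih (norm_nonneg _) (norm_cosAddSin_le_one hy hy1 h))
  refine (norm_mul_le _ _).trans ((mul_le_of_le_one_right (norm_nonneg _) (hpow _ _)).trans ?_)
  exact (norm_mul_le _ _).trans (mul_le_of_le_one_left (norm_nonneg _) (hpow _ _))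

/-- Each `n`-th power has frequencies up to `n * (1 / n) = 1`; the two powers together give `2`. -/
theorem conjApprox_mem_trigPoly (y K : A) {n : ℕ} (hn : n ≠ 0) :
    conjApprox y K n ∈ trigPoly A 2 := by
  have hn' : (n : ℝ) ≠ 0 := Nat.cast_ne_zero.2 hn
  have h := mul_mem_trigPoly (mul_mem_trigPoly
    (pow_mem_trigPoly (cosAddSin_mem_trigPoly y (1 / n)) n) (const_mem_trigPoly K))
    (pow_mem_trigPoly (cosAddSin_mem_trigPoly y (-1 / n)) n)
  convert! h using 1
  rotate_left
  · funext s
    simp only [conjApprox, Pi.mul_apply, Pi.pow_apply]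
    rw [one_div_mul_eq_div, div_mul_eq_mul_div, neg_one_mul]
  · rw [abs_div, abs_div, abs_neg, abs_one, Nat.abs_cast]
    field_simp
    norm_num

theorem hasDerivAt_pow_of_eq_one {f : ℝ → A} {f' : A} {x : ℝ} (hf : HasDerivAt f f' x)
    (h1 : f x = 1) (n : ℕ) : HasDerivAt (fun s => f s ^ n) (n • f') x := by
  induction n with
  | zero => simpa using hasDerivAt_const x (1 : A)
  | succ n ih =>
    simp only [pow_succ]
    convert! ih.fun_mul hf using 1
    simp [h1, add_smul]

/-- The derivative at `0` is already exact for every `n ≠ 0`, so no limit of derivatives is needed.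
-/
theorem hasDerivAt_conjApprox_zero (y K : A) {n : ℕ} (hn : n ≠ 0) :
    HasDerivAt (conjApprox y K n) (y * K - K * y) 0 := by
  have hn' : (n : ℝ) ≠ 0 := Nat.cast_ne_zero.2 hn
  have key : ∀ a : ℝ, HasDerivAt (fun s => cosAddSin y (a * s / n) ^ n) (a • y) 0 := fun a => by
    have h0 : HasDerivAt (fun s : ℝ => a * s / n) (a / n) 0 := by
      simpa using ((hasDerivAt_id (0 : ℝ)).const_mul a).div_const (n : ℝ)
    have h1 : HasDerivAt (fun s : ℝ => cosAddSin y (a * s / n)) ((a / n) • y) 0 := by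
      refine HasDerivAt.scomp (h := fun s : ℝ => a * s / n) (g₁ := cosAddSin y) (g₁' := y) 0 ?_ h0
      simpa using hasDerivAt_cosAddSin_zero y
    convert! hasDerivAt_pow_of_eq_one h1 (by simp [cosAddSin]) n using 1
    rw [← Nat.cast_smul_eq_nsmul ℝ, smul_smul, mul_div_cancel₀ a hn']
  have h := ((key 1).mul_const K).mul (key (-1))
  simp only [one_mul, neg_one_mul, one_smul] at h
  convert! h using 1
  simp [cosAddSin, sub_eq_add_neg]

theorem expConj_add_sub_expConj {y : A} (K : A) (l τ : ℝ) :
    expConj y K (l + τ) - expConj y K (l - τ) =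
      exp ((l - τ) • y) * (exp ((2 * τ) • y) * K - K * exp ((2 * τ) • y)) * exp (-(l + τ) • y) := by
  let +nondep : NormedAlgebra ℚ A := .restrictScalars ℚ ℂ A
  have hadd : ∀ a b : ℝ, exp (a • y) * exp (b • y) = exp ((a + b) • y) := fun a b => by
    rw [add_smul, exp_add_of_commute (((Commute.refl y).smul_left a).smul_right b)]
  rw [mul_sub, sub_mul, ← mul_assoc, hadd, mul_assoc _ _ (exp (-(l + τ) • y)),
    mul_assoc _ (K * _), mul_assoc K, hadd, expConj, expConj,
    show l - τ + 2 * τ = l + τ by ring, show 2 * τ + -(l + τ) = -(l - τ) by ring]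
  simp only [mul_assoc]

/-- The interpolation formula holds exactly for each approximant and passes to the orbit by
dominated convergence. Each difference of the orbit is the commutator with `exp ((2 * τ) • y)`
between two unitaries, so its norm does not depend on `k`. -/
theorem norm_skew_commutator_le {τ C : ℝ} {c : ℤ → ℂ} {l : ℤ → ℝ}
    (hC : HasSum (fun k => ‖c k‖) C)
    (h : ∀ d : ℝ, |d| ≤ 2 → HasSum (fun k => c k * (Complex.exp (d * (l k + τ : ℝ) * Complex.I) -
      Complex.exp (d * (l k - τ : ℝ) * Complex.I))) (d * Complex.I))
    {y : A} (hy : y ∈ skewAdjoint A) (hy1 : ‖y‖ ≤ 1) (K : A) :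
    ‖y * K - K * y‖ ≤ C * ‖exp ((2 * τ) • y) * K - K * exp ((2 * τ) • y)‖ := by
  have h1 : ∀ n : ℕ, n ≠ 0 → ∑' k, c k • (conjApprox y K n (l k + τ) - conjApprox y K n (l k - τ)) =
      y * K - K * y := fun n hn => by
    obtain ⟨F', h2, h3⟩ :=
      exists_hasDerivAt_hasSum_of_mem_trigPoly h (conjApprox_mem_trigPoly y K hn)
    rw [h3.tsum_eq, h2.unique (hasDerivAt_conjApprox_zero y K hn)]
  have h2 : Tendsto (fun n : ℕ => ∑' k, c k •
      (conjApprox y K n (l k + τ) - conjApprox y K n (l k - τ))) atTop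
      (𝓝 (∑' k, c k • (expConj y K (l k + τ) - expConj y K (l k - τ)))) := by
    refine tendsto_tsum_of_dominated_convergence (bound := fun k => ‖c k‖ * (‖K‖ + ‖K‖))
      (hC.summable.mul_right _) (fun k => ?_) (Eventually.of_forall fun n k => ?_)
    · exact ((tendsto_conjApprox hy hy1 K _).sub (tendsto_conjApprox hy hy1 K _)).const_smul _
    · rw [norm_smul]
      gcongr
      exact (norm_sub_le _ _).trans (add_le_add (norm_conjApprox_le hy hy1 K n _)
        (norm_conjApprox_le hy hy1 K n _))
  have h3 : y * K - K * y = ∑' k, c k • (expConj y K (l k + τ) - expConj y K (l k - τ)) := by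
    refine tendsto_nhds_unique (tendsto_const_nhds.congr' ?_) h2
    filter_upwards [eventually_ne_atTop 0] with n hn using (h1 n hn).symm
  rw [h3]
  refine tsum_of_norm_bounded (hC.mul_right _) fun k => ?_
  rw [norm_smul, expConj_add_sub_expConj, CStarRing.norm_mul_mem_unitary _ (exp_smul_mem_unitary hy _),
    CStarRing.norm_mem_unitary_mul _ (exp_smul_mem_unitary hy _)]

end Approx

/-! ### Fourier series of even convex functions. -/

section CosineSeries

/-- The cosine coefficients of a convex function on `[0, 1]` with vanishing derivative at `0`
alternate in sign and decay quadratically. -/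
theorem cosine_coeff_bounds {G D E : ℝ → ℝ} (hG : ContinuousOn G (Set.Icc 0 1))
    (hD : ContinuousOn D (Set.Icc 0 1)) (hGD : ∀ x ∈ Set.Ioo (0 : ℝ) 1, HasDerivAt G (D x) x)
    (hDE : ∀ x ∈ Set.Ioo (0 : ℝ) 1, HasDerivAt D (E x) x) (hE : ∀ x ∈ Set.Ioo (0 : ℝ) 1, 0 ≤ E x)
    (hD0 : D 0 = 0) {k : ℤ} (hk : k ≠ 0) :
    0 ≤ (-1) ^ k * (∫ x in (0 : ℝ)..1, G x * Real.cos (Real.pi * k * x)) ∧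
      (-1) ^ k * (∫ x in (0 : ℝ)..1, G x * Real.cos (Real.pi * k * x)) ≤
        2 * D 1 / Real.pi ^ 2 * (1 / (k : ℝ) ^ 2) := by
  set w : ℝ := Real.pi * k with hw
  have hw0 : w ≠ 0 := mul_ne_zero Real.pi_ne_zero (Int.cast_ne_zero.2 hk)
  have hcw : Real.cos w = (-1) ^ k := by
    rw [hw, mul_comm]; exact Real.cos_int_mul_pi k
  have hsw : Real.sin w = 0 := by
    rw [hw, mul_comm]; exact Real.sin_int_mul_pi k
  have hu : Set.uIcc (0 : ℝ) 1 = Set.Icc 0 1 := Set.uIcc_of_le zero_le_one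
  have hDi : IntervalIntegrable D MeasureTheory.volume 0 1 :=
    ContinuousOn.intervalIntegrable (hu ▸ hD)
  -- No bound on `E` near the endpoints is assumed: integrability comes from its sign and the
  -- continuity of `D`.
  have hEi : IntervalIntegrable E MeasureTheory.volume 0 1 := by
    apply intervalIntegral.intervalIntegrable_deriv_of_nonneg (g := D) (hu ▸ hD)
    · simpa using hDE
    · simpa using hE
  have hder : ∀ x : ℝ, HasDerivAt (fun x => w * x) w x := fun x => by
    simpa using (hasDerivAt_id x).const_mul w
  have h1 : ∫ x in (0 : ℝ)..1, G x * Real.cos (w * x) =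
      -∫ x in (0 : ℝ)..1, D x * (Real.sin (w * x) / w) := by
    have := intervalIntegral.integral_mul_deriv_eq_deriv_mul_of_hasDerivAt
      (a := 0) (b := 1) (u := G) (v := fun x => Real.sin (w * x) / w) (u' := D)
      (v' := fun x => Real.cos (w * x)) (hu ▸ hG) (by fun_prop) (by simpa using hGD)
      (fun x _ => by
        convert! ((hder x).sin).div_const w using 1
        field_simp) hDi (Continuous.intervalIntegrable (by fun_prop) _ _)
    rw [this]; simp [hsw]
  have h2 : ∫ x in (0 : ℝ)..1, D x * (Real.sin (w * x) / w) =
      -(D 1 * (-1) ^ k / w ^ 2) + (∫ x in (0 : ℝ)..1, E x * Real.cos (w * x)) / w ^ 2 := by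
    have := intervalIntegral.integral_mul_deriv_eq_deriv_mul_of_hasDerivAt
      (a := 0) (b := 1) (u := D) (v := fun x => -(Real.cos (w * x) / w ^ 2)) (u' := E)
      (v' := fun x => Real.sin (w * x) / w) (hu ▸ hD) (by fun_prop) (by simpa using hDE)
      (fun x _ => by
        convert! (((hder x).cos).div_const (w ^ 2)).fun_neg using 1
        field_simp) hEi (Continuous.intervalIntegrable (by fun_prop) _ _)
    rw [this, ← intervalIntegral.integral_div]
    simp only [mul_one, hcw, hD0, mul_neg, intervalIntegral.integral_neg, mul_div_assoc]
    ring
  have h3 : ∫ x in (0 : ℝ)..1, E x = D 1 := by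
    rw [intervalIntegral.integral_eq_sub_of_hasDerivAt_of_le zero_le_one hD hDE hEi, hD0, sub_zero]
  have h4 : |∫ x in (0 : ℝ)..1, E x * Real.cos (w * x)| ≤ D 1 := by
    rw [← h3]
    refine (intervalIntegral.abs_integral_le_integral_abs zero_le_one).trans ?_
    refine intervalIntegral.integral_mono_on_of_le_Ioo zero_le_one
      (hEi.mul_continuousOn (by fun_prop)).abs hEi fun x hx => ?_
    rw [abs_mul, abs_of_nonneg (hE x hx)]
    exact mul_le_of_le_one_right (hE x hx) (Real.abs_cos_le_one _)
  have hs : ((-1 : ℝ) ^ k) * (-1) ^ k = 1 := by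
    rw [← mul_zpow]; simp
  have h5 : |(-1) ^ k * ∫ x in (0 : ℝ)..1, E x * Real.cos (w * x)| ≤ D 1 := by
    rwa [abs_mul, abs_neg_one_zpow, one_mul]
  -- Two integrations by parts leave the boundary term `D 1`, which dominates the remaining integral
  -- because `∫ E = D 1`; this yields both sign and decay.
  have h6 : (-1) ^ k * (∫ x in (0 : ℝ)..1, G x * Real.cos (w * x)) =
      (D 1 - (-1) ^ k * ∫ x in (0 : ℝ)..1, E x * Real.cos (w * x)) / w ^ 2 := by
    rw [h1, h2]
    linear_combination (D 1 / w ^ 2) * hs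
  rw [h6]
  rw [abs_le] at h5
  have hw2 : 0 < w ^ 2 := by positivity
  constructor
  · exact div_nonneg (by linarith) hw2.le
  · have : 2 * D 1 / Real.pi ^ 2 * (1 / (k : ℝ) ^ 2) = 2 * D 1 / w ^ 2 := by
      rw [hw]; field_simp
    rw [this]
    gcongr
    linarith

theorem even_fourierCoeff {G : ℝ → ℝ} (hG : ContinuousOn G (Set.Icc (-1) 1))
    (heven : ∀ x, G (-x) = G x) [Fact ((0 : ℝ) < 2)] (k : ℤ) :
    fourierCoeff (AddCircle.liftIco 2 (-1) fun x => (G x : ℂ)) k =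
      ((∫ x in (0 : ℝ)..1, G x * Real.cos (Real.pi * k * x) : ℝ) : ℂ) := by
  rw [fourierCoeff_liftIco_eq, fourierCoeffOn_eq_integral]
  set h : ℝ → ℂ := fun x => Complex.exp (-(Real.pi * k * x : ℝ) * Complex.I) * G x with hh
  have hexp : Continuous fun x : ℝ => Complex.exp (-(Real.pi * k * x : ℝ) * Complex.I) := by
    fun_prop
  have hc : ContinuousOn h (Set.Icc (-1) 1) :=
    hexp.continuousOn.mul (Complex.continuous_ofReal.comp_continuousOn hG)
  have hi1 : IntervalIntegrable h MeasureTheory.volume (-1) 0 :=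
    ContinuousOn.intervalIntegrable (hc.mono (by
      rw [Set.uIcc_of_le (by norm_num)]; exact Set.Icc_subset_Icc le_rfl zero_le_one))
  have hi2 : IntervalIntegrable h MeasureTheory.volume 0 1 :=
    ContinuousOn.intervalIntegrable (hc.mono (by
      rw [Set.uIcc_of_le zero_le_one]; exact Set.Icc_subset_Icc (by norm_num) le_rfl))
  have hi3 : IntervalIntegrable (fun x => h (-x)) MeasureTheory.volume 0 1 := by
    refine ContinuousOn.intervalIntegrable (hc.comp continuous_neg.continuousOn fun x hx => ?_)
    rw [Set.uIcc_of_le zero_le_one] at hx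
    exact ⟨by linarith [hx.2], by linarith [hx.1]⟩
  have h1 : ∀ x : ℝ, fourier (-k) (x : AddCircle (-1 + 2 - -1 : ℝ)) • (G x : ℂ) = h x := fun x => by
    rw [fourier_coe_apply, smul_eq_mul, hh]
    congr 2
    push_cast
    ring
  have h2 : ∫ x in (-1 : ℝ)..(-1 + 2), fourier (-k) (x : AddCircle (-1 + 2 - -1 : ℝ)) • (G x : ℂ) =
      ∫ x in (0 : ℝ)..1, (h x + h (-x)) := by
    simp_rw [h1]
    rw [intervalIntegral.integral_add hi2 hi3, intervalIntegral.integral_comp_neg, neg_zero,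
      add_comm (∫ x in (0 : ℝ)..1, h x), intervalIntegral.integral_add_adjacent_intervals hi1 hi2]
    norm_num
  have h3 : ∀ x, h x + h (-x) = 2 * ((G x * Real.cos (Real.pi * k * x) : ℝ) : ℂ) := fun x => by
    simp only [hh, heven]
    push_cast
    rw [Complex.cos]
    ring_nf
  rw [h2]
  simp_rw [h3]
  rw [intervalIntegral.integral_const_mul, intervalIntegral.integral_ofReal]
  norm_num
  ring

theorem exists_fourier_of_even_convex {G D E : ℝ → ℝ} (hG : ContinuousOn G (Set.Icc (-1) 1))
    (heven : ∀ x, G (-x) = G x) (hG0 : ∀ x ∈ Set.Icc (0 : ℝ) 1, 0 ≤ G x)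
    (hD : ContinuousOn D (Set.Icc 0 1)) (hGD : ∀ x ∈ Set.Ioo (0 : ℝ) 1, HasDerivAt G (D x) x)
    (hDE : ∀ x ∈ Set.Ioo (0 : ℝ) 1, HasDerivAt D (E x) x) (hE : ∀ x ∈ Set.Ioo (0 : ℝ) 1, 0 ≤ E x)
    (hD0 : D 0 = 0) :
    ∃ a : ℤ → ℝ, HasSum (fun k => |a k|) (G 1) ∧ ∀ x ∈ Set.Icc (-1 : ℝ) 1,
      HasSum (fun k => (a k : ℂ) * Complex.exp (Real.pi * k * x * Complex.I)) (G x) := by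
  have : Fact ((0 : ℝ) < 2) := ⟨two_pos⟩
  let a : ℤ → ℝ := fun k => ∫ x in (0 : ℝ)..1, G x * Real.cos (Real.pi * k * x)
  have hG' : ContinuousOn G (Set.Icc 0 1) := hG.mono (Set.Icc_subset_Icc (by norm_num) le_rfl)
  have hb := fun k hk => cosine_coeff_bounds hG' hD hGD hDE hE hD0 (k := k) hk
  have habs : ∀ k, |a k| = (-1) ^ k * a k := fun k => by
    have h0 : 0 ≤ (-1) ^ k * a k := by
      rcases eq_or_ne k 0 with rfl | hk
      · simpa [a] using intervalIntegral.integral_nonneg zero_le_one hG0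
      · exact (hb k hk).1
    rw [← abs_of_nonneg h0, abs_mul, abs_neg_one_zpow, one_mul]
  have hsum : Summable a := by
    have hs : Summable fun k : ℤ => 2 * D 1 / Real.pi ^ 2 * (1 / (k : ℝ) ^ 2) :=
      (Real.summable_one_div_int_pow.2 one_lt_two).mul_left _
    refine Summable.of_norm_bounded_eventually hs ?_
    filter_upwards [(Set.finite_singleton (0 : ℤ)).compl_mem_cofinite] with k hk
    rw [Real.norm_eq_abs, habs]
    exact (hb k hk).2
  let F : C(AddCircle (2 : ℝ), ℂ) := ⟨AddCircle.liftIco 2 (-1) fun x => (G x : ℂ),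
    AddCircle.liftIco_continuous (by norm_num [heven]) (by
      norm_num
      exact Complex.continuous_ofReal.comp_continuousOn hG)⟩
  have hF : ∀ k, fourierCoeff F k = a k := fun k => even_fourierCoeff hG heven k
  have hser : ∀ x ∈ Set.Icc (-1 : ℝ) 1,
      HasSum (fun k => (a k : ℂ) * Complex.exp (Real.pi * k * x * Complex.I)) (G x) := by
    intro x hx
    have hIco : ∀ z ∈ Set.Ico (-1 : ℝ) 1, F (z : AddCircle (2 : ℝ)) = G z := fun z hz =>
      AddCircle.liftIco_coe_apply (a := (-1 : ℝ)) (p := 2) (f := fun x => (G x : ℂ))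
        ⟨hz.1, by linarith [hz.2]⟩
    have hFx : F (x : AddCircle (2 : ℝ)) = G x := by
      rcases eq_or_lt_of_le hx.2 with rfl | hx1
      · have h1 : ((1 : ℝ) : AddCircle (2 : ℝ)) = ((-1 : ℝ) : AddCircle (2 : ℝ)) := by
          rw [← sub_eq_zero, ← AddCircle.coe_sub]
          norm_num
        rw [h1, ← heven]
        exact hIco _ (by norm_num)
      · exact hIco _ ⟨hx.1, hx1⟩
    have h := has_pointwise_sum_fourier_series_of_summable (f := F)
      (by rw [funext hF]; exact Complex.ofRealCLM.summable hsum) (x : AddCircle (2 : ℝ))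
    rw [hFx] at h
    convert h using 2 with k
    rw [hF, fourier_coe_apply, smul_eq_mul]
    congr 2
    push_cast
    ring
  refine ⟨a, ?_, hser⟩
  -- At `x = 1` the exponentials equal `(-1) ^ k`, exactly the signs of the coefficients, so the
  -- series there is the absolute sum.
  have h1 := hser 1 ⟨by norm_num, le_rfl⟩
  rw [← Complex.hasSum_ofReal]
  convert h1 using 2 with k
  rw [habs]
  have : Complex.exp (Real.pi * k * (1 : ℝ) * Complex.I) = (-1) ^ k := by
    rw [← Complex.exp_pi_mul_I, ← Complex.exp_int_mul]
    congr 1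
    push_cast
    ring
  rw [this]
  push_cast
  ring

end CosineSeries

/-! ### The function `x / sin (t * x)` and the commutator bound. -/

section SinRatio

theorem sinc_pos {x : ℝ} (hx : |x| < Real.pi) : 0 < Real.sinc x := by
  have habs : Real.sinc x = Real.sinc |x| := by
    rcases abs_choice x with h | h <;> simp [h]
  rw [habs]
  rcases eq_or_lt_of_le (abs_nonneg x) with h | h
  · rw [← h, Real.sinc_zero]; exact one_pos
  · rw [Real.sinc_of_ne_zero h.ne']
    exact div_pos (Real.sin_pos_of_pos_of_lt_pi h hx) h

theorem abs_sin_sub_mul_cos_le {u : ℝ} (hu : 0 ≤ u) : |Real.sin u - u * Real.cos u| ≤ u ^ 3 := by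
  have h1 : u - u ^ 3 / 6 ≤ Real.sin u := by
    rcases eq_or_lt_of_le hu with rfl | h
    · simp
    · exact (Real.sin_gt_sub_cube h).le
  have h2 := Real.sin_le hu
  have h3 := mul_le_mul_of_nonneg_left (Real.one_sub_sq_div_two_le_cos (x := u)) hu
  have h4 := mul_le_mul_of_nonneg_left (Real.cos_le_one u) hu
  have h5 : 0 ≤ u ^ 3 := by positivity
  rw [abs_le]
  constructor <;> nlinarith

/-- The derivative of `x / sin (t * x)`. -/
noncomputable def sinRatioDeriv (t x : ℝ) : ℝ :=
  (Real.sin (t * x) - t * x * Real.cos (t * x)) / Real.sin (t * x) ^ 2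

/-- At `0` the quotient is `0 / 0 = 0` by convention, which is also its limit: `|sin u - u * cos u|
≤ u ^ 3` bounds it by `u / sinc u ^ 2` with `u = t * x`. -/
theorem continuousWithinAt_sinRatioDeriv_zero {t : ℝ} (ht : 0 < t) :
    ContinuousWithinAt (sinRatioDeriv t) (Set.Icc 0 1) 0 := by
  have h0 : sinRatioDeriv t 0 = 0 := by simp [sinRatioDeriv]
  rw [ContinuousWithinAt, h0]
  have h1 : Tendsto (fun x : ℝ => t * x / Real.sinc (t * x) ^ 2) (𝓝[Set.Icc 0 1] 0) (𝓝 0) := by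
    have : ContinuousAt (fun x : ℝ => t * x / Real.sinc (t * x) ^ 2) 0 := by
      refine ContinuousAt.div (by fun_prop) ?_ (by simp)
      exact ((Real.continuous_sinc.comp (continuous_const_mul t)).pow 2).continuousAt
    have h2 := this.tendsto
    simp only [mul_zero, zero_div] at h2
    exact h2.mono_left nhdsWithin_le_nhds
  refine squeeze_zero_norm' ?_ h1
  filter_upwards [self_mem_nhdsWithin] with x hx
  rcases eq_or_lt_of_le hx.1 with rfl | hx0
  · simp [h0]
  have hu : 0 < t * x := mul_pos ht hx0
  rw [sinRatioDeriv, norm_div, Real.norm_eq_abs, Real.norm_eq_abs, abs_of_nonneg (sq_nonneg (Real.sin _)),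
    Real.sinc_of_ne_zero hu.ne', div_pow, div_div_eq_mul_div]
  gcongr
  calc _ ≤ (t * x) ^ 3 := abs_sin_sub_mul_cos_le hu.le
    _ = _ := by ring

theorem hasDerivAt_sinRatio {t x : ℝ} (hs : Real.sin (t * x) ≠ 0) :
    HasDerivAt (fun x => x / Real.sin (t * x)) (sinRatioDeriv t x) x := by
  have h := (hasDerivAt_id x).fun_div (((hasDerivAt_id x).const_mul t).sin) hs
  convert! h using 1
  simp only [sinRatioDeriv, id, mul_one, one_mul]
  ring

theorem hasDerivAt_sinRatioDeriv {t x : ℝ} (hs : Real.sin (t * x) ≠ 0) :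
    HasDerivAt (sinRatioDeriv t)
      (t * (t * x * (1 + Real.cos (t * x) ^ 2) - 2 * Real.sin (t * x) * Real.cos (t * x)) /
        Real.sin (t * x) ^ 3) x := by
  have hi : HasDerivAt (fun x => t * x) t x := by simpa using (hasDerivAt_id x).const_mul t
  have h := (hi.sin.fun_sub (hi.fun_mul hi.cos)).fun_div (hi.sin.fun_pow 2) (pow_ne_zero 2 hs)
  convert! h using 1
  field_simp
  linear_combination (-(t ^ 2 * x * Real.sin (t * x))) * Real.sin_sq_add_cos_sq (t * x)

theorem sinRatio_second_deriv_nonneg {t x : ℝ} (hx : 0 ≤ t * x) (ht : 0 ≤ t)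
    (hs : 0 < Real.sin (t * x)) :
    0 ≤ t * (t * x * (1 + Real.cos (t * x) ^ 2) - 2 * Real.sin (t * x) * Real.cos (t * x)) /
        Real.sin (t * x) ^ 3 := by
  refine div_nonneg (mul_nonneg ht ?_) (by positivity)
  have h1 := Real.sin_le hx
  -- If `cos u ≥ 0`, then `2 * sin u * cos u ≤ 2 * u * cos u ≤ u * (1 + cos u ^ 2)`; otherwise the
  -- subtracted term is nonpositive.
  rcases le_total 0 (Real.cos (t * x)) with hc | hc
  · nlinarith [mul_le_mul_of_nonneg_right h1 hc, mul_nonneg hx (sq_nonneg (1 - Real.cos (t * x)))]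
  · nlinarith [mul_nonneg hs.le (neg_nonneg.2 hc), mul_nonneg hx (sq_nonneg (Real.cos (t * x)))]

theorem exists_sinRatio_fourier {t : ℝ} (ht : t ∈ Set.Ioo 0 Real.pi) :
    ∃ a : ℤ → ℝ, HasSum (fun k => |a k|) (1 / Real.sin t) ∧ ∀ x ∈ Set.Icc (-1 : ℝ) 1,
      HasSum (fun k => (a k : ℂ) * Complex.exp (Real.pi * k * x * Complex.I) * Real.sin (t * x))
        x := by
  have ht0 : 0 < t := ht.1
  have hpi : ∀ x ∈ Set.Icc (-1 : ℝ) 1, |t * x| < Real.pi := fun x hx => by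
    rw [abs_mul, abs_of_pos ht0]
    exact (mul_le_of_le_one_right ht0.le (abs_le.2 hx)).trans_lt ht.2
  have hspos : ∀ x ∈ Set.Ioc (0 : ℝ) 1, 0 < Real.sin (t * x) := fun x hx =>
    Real.sin_pos_of_pos_of_lt_pi (mul_pos ht0 hx.1)
      ((le_abs_self _).trans_lt (hpi x ⟨by linarith [hx.1], hx.2⟩))
  -- Writing the ratio through `sinc` fills the removable singularity at `0` with the value `1 / t`.
  let G : ℝ → ℝ := fun x => 1 / (t * Real.sinc (t * x))
  have hGx : ∀ x, x ≠ 0 → G x = x / Real.sin (t * x) := fun x hx => by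
    have : t * x ≠ 0 := mul_ne_zero ht0.ne' hx
    simp only [G]
    rw [Real.sinc_of_ne_zero this]
    field_simp
  obtain ⟨a, ha, hs⟩ := exists_fourier_of_even_convex (G := G) (D := sinRatioDeriv t)
    (E := fun x => t * (t * x * (1 + Real.cos (t * x) ^ 2) - 2 * Real.sin (t * x) * Real.cos (t * x)) /
        Real.sin (t * x) ^ 3)
    (by
      refine ContinuousOn.div continuousOn_const ?_ fun x hx =>
        (mul_pos ht0 (sinc_pos (hpi x hx))).ne'
      exact (continuous_const.mul
        (Real.continuous_sinc.comp (continuous_const_mul t))).continuousOn)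
    (fun x => by simp only [G, mul_neg, Real.sinc_neg])
    (fun x hx => one_div_nonneg.2
      (mul_pos ht0 (sinc_pos (hpi x ⟨by linarith [hx.1], hx.2⟩))).le)
    (fun x hx => by
      rcases eq_or_lt_of_le hx.1 with rfl | hx0
      · exact continuousWithinAt_sinRatioDeriv_zero ht0
      · exact (hasDerivAt_sinRatioDeriv (hspos x ⟨hx0, hx.2⟩).ne').continuousAt.continuousWithinAt)
    (fun x hx => (hasDerivAt_sinRatio (hspos x ⟨hx.1, hx.2.le⟩).ne').congr_of_eventuallyEq (by
      filter_upwards [isOpen_ne.mem_nhds hx.1.ne'] with y hy using hGx y hy))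
    (fun x hx => hasDerivAt_sinRatioDeriv (hspos x ⟨hx.1, hx.2.le⟩).ne')
    (fun x hx => sinRatio_second_deriv_nonneg (mul_pos ht0 hx.1).le ht0.le
      (hspos x ⟨hx.1, hx.2.le⟩))
    (by simp [sinRatioDeriv])
  refine ⟨a, by simpa [hGx 1 one_ne_zero] using ha, fun x hx => ?_⟩
  have h := (hs x hx).mul_right (Real.sin (t * x) : ℂ)
  suffices hx' : (x : ℂ) = G x * Real.sin (t * x) by
    rw [← hx'] at h
    exact h
  rcases eq_or_ne x 0 with rfl | hx0
  · simp
  · rw [hGx x hx0, ← Complex.ofReal_mul, div_mul_cancel₀]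
    have h := (sinc_pos (hpi x hx)).ne'
    rw [Real.sinc_of_ne_zero (mul_ne_zero ht0.ne' hx0)] at h
    exact fun h0 => h (by rw [h0, zero_div])

open NormedSpace in
theorem norm_skew_commutator_le_sin {A : Type*} [CStarAlgebra A] {t : ℝ}
    (ht : t ∈ Set.Ioo 0 Real.pi) {y : A} (hy : y ∈ skewAdjoint A) (hy1 : ‖y‖ ≤ 1) (K : A) :
    ‖y * K - K * y‖ ≤ 1 / Real.sin t * ‖exp (t • y) * K - K * exp (t • y)‖ := by
  obtain ⟨a, ha, hs⟩ := exists_sinRatio_fourier ht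
  -- A frequency `d ∈ [-2, 2]` corresponds to `x = d / 2`; multiplying the series by `2 * I` turns
  -- `sin (t * x)` into a difference of exponentials and the sum `x` into `d * I`.
  have key := norm_skew_commutator_le (τ := t / 2) (C := 1 / Real.sin t) (c := fun k => (a k : ℂ))
    (l := fun k => Real.pi * k / 2) (by simpa using ha) (fun d hd => ?_) hy hy1 K
  · rwa [mul_div_cancel₀ t two_ne_zero] at key
  · have h := (hs (d / 2) (by
      rw [abs_le] at hd
      exact ⟨by linarith [hd.1], by linarith [hd.2]⟩)).mul_right (2 * Complex.I)
    convert! h using 1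
    · funext k
      have h2 : ∀ z : ℂ, 2 * Complex.sin z * Complex.I =
          Complex.exp (z * Complex.I) - Complex.exp (-z * Complex.I) := fun z => by
        rw [Complex.sin]
        linear_combination (Complex.exp (-z * Complex.I) - Complex.exp (z * Complex.I)) *
          Complex.I_sq
      have h3 : ∀ p q s : ℂ, p * q * s * (2 * Complex.I) = p * (q * (2 * s * Complex.I)) :=
        fun p q s => by ring
      rw [h3, Complex.ofReal_sin, h2, mul_sub (Complex.exp _),
        ← Complex.exp_add, ← Complex.exp_add]
      congr 3 <;> (push_cast; ring)
    · push_cast; ring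

end SinRatio

/-! ### The commutator estimate for self-adjoint `x`. -/

section SelfAdjoint
open NormedSpace

theorem norm_rpow_commutator_le_of_isSelfAdjoint {A : Type*} [CStarAlgebra A] [PartialOrder A]
    [StarOrderedRing A] {r t : ℝ} (hr : r ∈ Set.Ioo (0 : ℝ) 1) (ht : t ∈ Set.Ioo 0 Real.pi)
    {a x : A} (ha : 0 ≤ a) (hx : IsSelfAdjoint x) :
    ‖a ^ r * x - x * a ^ r‖ ≤ t ^ r / Real.sin t * ‖x‖ ^ (1 - r) * ‖a * x - x * a‖ ^ r := by
  rcases eq_or_ne x 0 with rfl | hx0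
  · simp [Real.zero_rpow hr.1.ne']
  have hn : 0 < ‖x‖ := norm_pos_iff.2 hx0
  have hsin : 0 < Real.sin t := Real.sin_pos_of_pos_of_lt_pi ht.1 ht.2
  set y : A := (Complex.I * (‖x‖⁻¹ : ℝ)) • x with hy
  have hnc : ‖(Complex.I * (‖x‖⁻¹ : ℝ) : ℂ)‖ = ‖x‖⁻¹ := by
    rw [norm_mul, Complex.norm_I, one_mul, Complex.norm_real, norm_inv, norm_norm]
  have hys : y ∈ skewAdjoint A := by
    rw [skewAdjoint.mem_iff, hy, star_smul, hx.star_eq, ← neg_smul]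
    simp
  have hy1 : ‖y‖ ≤ 1 := by
    rw [hy, norm_smul, hnc, inv_mul_cancel₀ hn.ne']
  have hcomm : ∀ K : A, ‖y * K - K * y‖ = ‖x‖⁻¹ * ‖K * x - x * K‖ := fun K => by
    rw [hy, smul_mul_assoc, mul_smul_comm, ← smul_sub, norm_smul, hnc, norm_sub_rev]
  have h1 := norm_skew_commutator_le_sin ht hys hy1 (a ^ r)
  have h2 := norm_unitary_commutator_rpow_le hr ha (exp_smul_mem_unitary hys t)
  have h3 := norm_exp_commutator_le hys a ht.1.le
  rw [hcomm] at h1 h3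
  have h4 : ‖x‖⁻¹ * ‖a ^ r * x - x * a ^ r‖ ≤
      1 / Real.sin t * (t * (‖x‖⁻¹ * ‖a * x - x * a‖)) ^ r :=
    h1.trans (mul_le_mul_of_nonneg_left
      (h2.trans (Real.rpow_le_rpow (norm_nonneg _) h3 hr.1.le)) (one_div_pos.2 hsin).le)
  rw [inv_mul_le_iff₀ hn] at h4
  refine h4.trans_eq ?_
  rw [Real.mul_rpow ht.1.le (by positivity), Real.mul_rpow (by positivity) (norm_nonneg _),
    Real.inv_rpow hn.le, Real.rpow_sub hn, Real.rpow_one]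
  ring

end SelfAdjoint

/-! ### Reduction of the general case to self-adjoint block operators. -/

section Doubling

theorem continuous_starAlgHom {A B : Type*} [CStarAlgebra A] [CStarAlgebra B] (φ : A →⋆ₐ[ℂ] B) :
    Continuous φ :=
  AddMonoidHomClass.continuous_of_bound φ 1 fun a => by
    simpa using NonUnitalStarAlgHom.norm_apply_le φ a

theorem exists_map_eq_cfc {D A B C : Type*} [CStarAlgebra D] [CStarAlgebra A] [CStarAlgebra B]
    [CStarAlgebra C] (p : D →⋆ₐ[ℂ] A) (q : D →⋆ₐ[ℂ] B) (φ : D →⋆ₐ[ℂ] C) {f : ℝ → ℝ}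
    (hf : Continuous f) {d : D} (hd : IsSelfAdjoint d) :
    ∃ e, p e = cfc f (p d) ∧ q e = cfc f (q d) ∧ φ e = cfc f (φ d) :=
  ⟨cfc f d, StarAlgHomClass.map_cfc (S := ℂ) p f d hf.continuousOn (continuous_starAlgHom p) hd (hd.map p),
    StarAlgHomClass.map_cfc (S := ℂ) q f d hf.continuousOn (continuous_starAlgHom q) hd (hd.map q),
    StarAlgHomClass.map_cfc (S := ℂ) φ f d hf.continuousOn (continuous_starAlgHom φ) hd (hd.map φ)⟩

/-- Powers are rewritten as real functional calculus, which passes through the two projections and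
`φ` without using an order on `A × B`. -/
theorem map_rpow_prod {A B C : Type*} [CStarAlgebra A] [PartialOrder A] [StarOrderedRing A]
    [CStarAlgebra B] [PartialOrder B] [StarOrderedRing B] [CStarAlgebra C] [PartialOrder C]
    [StarOrderedRing C] (φ : (A × B) →⋆ₐ[ℂ] C) {a : A} {b : B}
    (ha : 0 ≤ a) (hb : 0 ≤ b) (hab : 0 ≤ φ (a, b)) {r : ℝ} (hr : 0 < r) :
    φ (a, b) ^ r = φ (a ^ r, b ^ r) := by
  obtain ⟨e, h1, h2, h3⟩ := exists_map_eq_cfc (StarAlgHom.fst ℂ A B) (StarAlgHom.snd ℂ A B) φ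
    (Real.continuous_rpow_const hr.le) (d := (a, b)) (Prod.ext ha.isSelfAdjoint hb.isSelfAdjoint)
  rw [CFC.rpow_eq_cfc_real ha, CFC.rpow_eq_cfc_real hb, CFC.rpow_eq_cfc_real hab, ← h3]
  exact congrArg φ (Prod.ext h1 h2)

variable {H : Type*} [NormedAddCommGroup H] [InnerProductSpace ℂ H]

/-- The block diagonal operator on `H ⊕ H` with the given diagonal entries. -/
noncomputable def blockDiag (A B : H →L[ℂ] H) : WithLp 2 (H × H) →L[ℂ] WithLp 2 (H × H) :=
  (WithLp.prodContinuousLinearEquiv 2 ℂ H H).symm.toContinuousLinearMap ∘L (A.prodMap B) ∘L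
    (WithLp.prodContinuousLinearEquiv 2 ℂ H H).toContinuousLinearMap

/-- The exchange of the two summands of `H ⊕ H`. -/
noncomputable def blockSwap (H : Type*) [NormedAddCommGroup H] [InnerProductSpace ℂ H] :
    WithLp 2 (H × H) →L[ℂ] WithLp 2 (H × H) :=
  (WithLp.prodContinuousLinearEquiv 2 ℂ H H).symm.toContinuousLinearMap ∘L
    ((ContinuousLinearMap.snd ℂ H H).prod (ContinuousLinearMap.fst ℂ H H)) ∘L
    (WithLp.prodContinuousLinearEquiv 2 ℂ H H).toContinuousLinearMap

theorem blockDiag_apply (A B : H →L[ℂ] H) (v : WithLp 2 (H × H)) :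
    blockDiag A B v = WithLp.toLp 2 (A v.fst, B v.snd) := rfl

theorem blockSwap_apply (v : WithLp 2 (H × H)) :
    blockSwap H v = WithLp.toLp 2 (v.snd, v.fst) := rfl

theorem blockDiag_mul (A B C D : H →L[ℂ] H) :
    blockDiag A B * blockDiag C D = blockDiag (A * C) (B * D) := rfl

theorem blockDiag_sub (A B C D : H →L[ℂ] H) :
    blockDiag A B - blockDiag C D = blockDiag (A - C) (B - D) := rfl

theorem blockSwap_mul_blockDiag (A B : H →L[ℂ] H) :
    blockSwap H * blockDiag A B = blockDiag B A * blockSwap H := rfl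

theorem blockSwap_mul_self : blockSwap H * blockSwap H = 1 := rfl

variable [CompleteSpace H]

theorem star_blockDiag (A B : H →L[ℂ] H) :
    star (blockDiag A B) = blockDiag (star A) (star B) := by
  symm
  rw [ContinuousLinearMap.star_eq_adjoint (blockDiag A B), ContinuousLinearMap.eq_adjoint_iff]
  intro v w
  simp [blockDiag_apply, WithLp.prod_inner_apply, ContinuousLinearMap.star_eq_adjoint,
    ContinuousLinearMap.adjoint_inner_left]

theorem star_blockSwap : star (blockSwap H) = blockSwap H := by
  symm
  rw [ContinuousLinearMap.star_eq_adjoint (blockSwap H), ContinuousLinearMap.eq_adjoint_iff]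
  intro v w
  simp [blockSwap_apply, WithLp.prod_inner_apply, add_comm]

theorem blockSwap_mem_unitary : blockSwap H ∈ unitary (WithLp 2 (H × H) →L[ℂ] WithLp 2 (H × H)) := by
  rw [Unitary.mem_iff, star_blockSwap]
  exact ⟨blockSwap_mul_self, blockSwap_mul_self⟩

/-- Block diagonal operators as a star algebra homomorphism. -/
noncomputable def blockDiagHom (H : Type*) [NormedAddCommGroup H] [InnerProductSpace ℂ H]
    [CompleteSpace H] :
    ((H →L[ℂ] H) × (H →L[ℂ] H)) →⋆ₐ[ℂ] (WithLp 2 (H × H) →L[ℂ] WithLp 2 (H × H)) where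
  toFun p := blockDiag p.1 p.2
  map_one' := rfl
  map_mul' _ _ := rfl
  map_zero' := rfl
  map_add' _ _ := rfl
  commutes' _ := rfl
  map_star' p := (star_blockDiag p.1 p.2).symm

theorem blockDiagHom_injective : Function.Injective (blockDiagHom H) := by
  intro p q h
  have h' : ∀ v : WithLp 2 (H × H), blockDiag p.1 p.2 v = blockDiag q.1 q.2 v := fun v =>
    DFunLike.congr_fun h v
  ext x
  · exact congrArg WithLp.fst (h' (WithLp.toLp 2 (x, 0)))
  · exact congrArg WithLp.snd (h' (WithLp.toLp 2 (0, x)))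

theorem norm_blockDiag (A B : H →L[ℂ] H) : ‖blockDiag A B‖ = max ‖A‖ ‖B‖ := by
  have := NonUnitalStarAlgHom.norm_map (blockDiagHom H) blockDiagHom_injective (A, B)
  rwa [Prod.norm_mk] at this

theorem blockDiag_nonneg {A B : H →L[ℂ] H} (hA : 0 ≤ A) (hB : 0 ≤ B) : 0 ≤ blockDiag A B :=
  map_nonneg (blockDiagHom H) (a := (A, B)) ⟨hA, hB⟩

theorem blockDiag_rpow {A B : H →L[ℂ] H} (hA : 0 ≤ A) (hB : 0 ≤ B) {r : ℝ} (hr : 0 < r) :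
    (blockDiag A B) ^ r = blockDiag (A ^ r) (B ^ r) :=
  map_rpow_prod (blockDiagHom H) hA hB (blockDiag_nonneg hA hB) hr

theorem norm_mul_blockSwap (T : WithLp 2 (H × H) →L[ℂ] WithLp 2 (H × H)) :
    ‖T * blockSwap H‖ = ‖T‖ :=
  CStarRing.norm_mul_mem_unitary T blockSwap_mem_unitary

theorem norm_rpow_mul_sub_mul_rpow_le {r t : ℝ} (hr : r ∈ Set.Ioo (0 : ℝ) 1)
    (ht : t ∈ Set.Ioo 0 Real.pi) {A B : H →L[ℂ] H} (X : H →L[ℂ] H) (hA : 0 ≤ A) (hB : 0 ≤ B) :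
    ‖A ^ r * X - X * B ^ r‖ ≤ t ^ r / Real.sin t * ‖X‖ ^ (1 - r) * ‖A * X - X * B‖ ^ r := by
  have hmulJ : ∀ C D : H →L[ℂ] H, ‖blockDiag C D * blockSwap H‖ = max ‖C‖ ‖D‖ := fun C D => by
    rw [norm_mul_blockSwap, norm_blockDiag]
  have hcomm : ∀ C D : H →L[ℂ] H, blockDiag C D * (blockDiag X (star X) * blockSwap H) -
      blockDiag X (star X) * blockSwap H * blockDiag C D =
      blockDiag (C * X - X * D) (D * star X - star X * C) * blockSwap H := fun C D => by
    rw [mul_assoc _ (blockSwap H), blockSwap_mul_blockDiag, ← mul_assoc, ← mul_assoc, ← sub_mul,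
      blockDiag_mul, blockDiag_mul, blockDiag_sub]
  have hX : IsSelfAdjoint (blockDiag X (star X) * blockSwap H) := by
    rw [isSelfAdjoint_iff, star_mul, star_blockSwap, star_blockDiag, star_star,
      blockSwap_mul_blockDiag]
  -- The second block is minus the adjoint of the first, so the maximum of the two norms loses
  -- nothing.
  have hD : ‖B * star X - star X * A‖ = ‖A * X - X * B‖ := by
    rw [← norm_star (A * X - X * B), star_sub, star_mul, star_mul, hA.isSelfAdjoint.star_eq,
      hB.isSelfAdjoint.star_eq, norm_sub_rev]
  have h := norm_rpow_commutator_le_of_isSelfAdjoint hr ht (blockDiag_nonneg hA hB) hX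
  rw [blockDiag_rpow hA hB hr.1, hcomm, hcomm, hmulJ, hmulJ, hmulJ, hD, norm_star, max_self,
    max_self] at h
  exact (le_max_left _ _).trans h

end Doubling

/-! ### Attainment of the constants and the numerical bound. -/

section Constants

theorem gammaTilde_isLeast {r : ℝ} (hr : r ∈ Set.Ioo (0 : ℝ) 1) :
    IsLeast (sinRatioValues r) (gammaTilde r) := by
  -- This is the reciprocal of the ratio, extended continuously to `[0, π]`; it vanishes at both
  -- endpoints, so its maximum is interior.
  let f : ℝ → ℝ := fun t => Real.sinc t * t ^ (1 - r)
  have hf : Continuous f :=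
    Real.continuous_sinc.mul (Real.continuous_rpow_const (by linarith [hr.2]))
  have hfx : ∀ t ∈ Set.Ioo 0 Real.pi, f t = (t ^ r / Real.sin t)⁻¹ := fun t ht => by
    simp only [f]
    rw [Real.sinc_of_ne_zero ht.1.ne', Real.rpow_sub ht.1, Real.rpow_one, inv_div]
    have := ht.1.ne'
    field_simp
  have hpos : ∀ t ∈ Set.Ioo 0 Real.pi, 0 < t ^ r / Real.sin t := fun t ht =>
    div_pos (Real.rpow_pos_of_pos ht.1 _) (Real.sin_pos_of_pos_of_lt_pi ht.1 ht.2)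
  obtain ⟨m, hm, hmax⟩ := (isCompact_Icc (a := (0 : ℝ)) (b := Real.pi)).exists_isMaxOn
    (Set.nonempty_Icc.2 Real.pi_pos.le) hf.continuousOn
  have hhalf : Real.pi / 2 ∈ Set.Ioo 0 Real.pi := ⟨by positivity, by linarith [Real.pi_pos]⟩
  have hfm : 0 < f m := by
    refine lt_of_lt_of_le ?_ (hmax (Set.Ioo_subset_Icc_self hhalf))
    rw [hfx _ hhalf]
    exact inv_pos.2 (hpos _ hhalf)
  have hm' : m ∈ Set.Ioo 0 Real.pi := by
    refine ⟨lt_of_le_of_ne hm.1 ?_, lt_of_le_of_ne hm.2 ?_⟩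
    · rintro rfl
      simp [f, Real.zero_rpow (by linarith [hr.2] : 1 - r ≠ 0)] at hfm
    · rintro rfl
      simp [f, Real.sinc_of_ne_zero Real.pi_ne_zero] at hfm
  have hleast : IsLeast (sinRatioValues r) (m ^ r / Real.sin m) := by
    refine ⟨⟨m, hm', rfl⟩, ?_⟩
    rintro _ ⟨t, ht, rfl⟩
    have h := hmax (Set.Ioo_subset_Icc_self ht)
    rw [Set.mem_ofPred_eq, hfx t ht, hfx m hm'] at h
    exact (inv_le_inv₀ (hpos t ht) (hpos m hm')).1 h
  rwa [gammaTilde, hleast.csInf_eq]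

theorem norm_rpow_mul_sub_mul_rpow_le_gammaTilde {r : ℝ} (hr : r ∈ Set.Ioo (0 : ℝ) 1)
    {H : Type*} [NormedAddCommGroup H] [InnerProductSpace ℂ H] [CompleteSpace H]
    {A B : H →L[ℂ] H} (X : H →L[ℂ] H) (hA : 0 ≤ A) (hB : 0 ≤ B) :
    ‖A ^ r * X - X * B ^ r‖ ≤ gammaTilde r * ‖X‖ ^ (1 - r) * ‖A * X - X * B‖ ^ r := by
  obtain ⟨t, ht, h⟩ := (gammaTilde_isLeast hr).1
  rw [← h]
  exact norm_rpow_mul_sub_mul_rpow_le hr ht X hA hB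

theorem gammaTilde_mem_commutatorConstants {r : ℝ} (hr : r ∈ Set.Ioo (0 : ℝ) 1) :
    gammaTilde r ∈ commutatorConstants.{u} r := by
  refine ⟨?_, fun H _ _ _ A X hA => norm_rpow_mul_sub_mul_rpow_le_gammaTilde hr X hA hA⟩
  obtain ⟨t, ht, h⟩ := (gammaTilde_isLeast hr).1
  rw [← h]
  exact (div_pos (Real.rpow_pos_of_pos ht.1 _) (Real.sin_pos_of_pos_of_lt_pi ht.1 ht.2)).le

theorem isClosed_commutatorConstants (r : ℝ) : IsClosed (commutatorConstants.{u} r) := by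
  refine IsSeqClosed.isClosed fun c C hc hC => ⟨ge_of_tendsto' hC fun n => (hc n).1, ?_⟩
  intro H _ _ _ A X hA
  exact ge_of_tendsto' ((hC.mul_const _).mul_const _) fun n => (hc n).2 H A X hA

theorem gammaZero_isLeast {r : ℝ} (hr : r ∈ Set.Ioo (0 : ℝ) 1) :
    IsLeast (commutatorConstants.{u} r) (gammaZero.{u} r) := by
  have hb : BddBelow (commutatorConstants.{u} r) := ⟨0, fun _ hC => hC.1⟩
  exact ⟨(isClosed_commutatorConstants r).csInf_mem
    ⟨_, gammaTilde_mem_commutatorConstants hr⟩ hb, fun _ hC => csInf_le hb hC⟩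

/-- The Taylor polynomial of degree seven is a lower bound for the sine. -/
theorem taylor_le_sin {x : ℝ} (hx : 0 ≤ x) :
    x - x ^ 3 / 6 + x ^ 5 / 120 - x ^ 7 / 5040 ≤ Real.sin x := by
  have mono : ∀ f f' : ℝ → ℝ, (∀ x, HasDerivAt f (f' x) x) → f 0 = 0 → (∀ x, 0 ≤ x → 0 ≤ f' x) →
      ∀ x, 0 ≤ x → 0 ≤ f x := fun f f' hf h0 hf' x hx => by
    have h := monotoneOn_of_hasDerivWithinAt_nonneg (convex_Ici (0 : ℝ)) (f := f) (f' := f')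
      (fun y _ => (hf y).continuousAt.continuousWithinAt) (fun y _ => (hf y).hasDerivWithinAt)
      (fun y hy => hf' y (interior_subset hy))
    rw [← h0]
    exact h (Set.self_mem_Ici) hx hx
  have hp : ∀ (n : ℕ) (x : ℝ), HasDerivAt (fun x : ℝ => x ^ n) (n * x ^ (n - 1)) x := hasDerivAt_pow
  have c4 : ∀ x : ℝ, 0 ≤ x → 0 ≤ 1 - x ^ 2 / 2 + x ^ 4 / 24 - Real.cos x := by
    refine mono _ (fun x => Real.sin x - (x - x ^ 3 / 6)) (fun x => ?_) (by simp) (fun x hx => ?_)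
    · convert! ((((hp 2 x).div_const 2).fun_neg.const_add 1).fun_add
        ((hp 4 x).div_const 24)).fun_sub (Real.hasDerivAt_cos x) using 1
      push_cast; ring
    · rcases eq_or_lt_of_le hx with rfl | h
      · simp
      · linarith [Real.sin_gt_sub_cube h]
  have c5 : ∀ x : ℝ, 0 ≤ x → 0 ≤ x - x ^ 3 / 6 + x ^ 5 / 120 - Real.sin x := by
    refine mono _ _ (fun x => ?_) (by simp) c4
    convert! ((((hp 1 x).fun_sub ((hp 3 x).div_const 6))).fun_add
      ((hp 5 x).div_const 120)).fun_sub (Real.hasDerivAt_sin x) using 1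
    · simp
    · push_cast; ring
  have c6 : ∀ x : ℝ, 0 ≤ x → 0 ≤ Real.cos x - (1 - x ^ 2 / 2 + x ^ 4 / 24 - x ^ 6 / 720) := by
    refine mono _ _ (fun x => ?_) (by simp) c5
    convert! (Real.hasDerivAt_cos x).fun_sub (((((hp 2 x).div_const 2).fun_neg.const_add 1).fun_add
        ((hp 4 x).div_const 24)).fun_sub ((hp 6 x).div_const 720)) using 1
    push_cast; ring
  have c7 : ∀ x : ℝ, 0 ≤ x →
      0 ≤ Real.sin x - (x - x ^ 3 / 6 + x ^ 5 / 120 - x ^ 7 / 5040) := by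
    refine mono _ _ (fun x => ?_) (by simp) c6
    convert! (Real.hasDerivAt_sin x).fun_sub ((((hp 1 x).fun_sub ((hp 3 x).div_const 6)).fun_add
      ((hp 5 x).div_const 120)).fun_sub ((hp 7 x).div_const 5040)) using 1
    · simp
    · push_cast; ring
  linarith [c7 x hx]

theorem gammaTilde_half_le : gammaTilde (1 / 2) ≤ 1.1748 := by
  -- The minimiser solves `tan t = 2 * t`, so `t ≈ 1.1656`; `7 / 6` is a nearby rational.
  have hmem : (7 / 6 : ℝ) ∈ Set.Ioo 0 Real.pi := ⟨by norm_num, by linarith [Real.pi_gt_three]⟩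
  refine ((gammaTilde_isLeast (by norm_num)).2 ⟨7 / 6, hmem, rfl⟩).trans ?_
  have h := taylor_le_sin (x := 7 / 6) (by norm_num)
  rw [div_le_iff₀ (Real.sin_pos_of_pos_of_lt_pi hmem.1 hmem.2), ← Real.sqrt_eq_rpow,
    Real.sqrt_le_iff]
  have h1 : (0.91943 : ℝ) ≤ Real.sin (7 / 6) := le_trans (by norm_num) h
  exact ⟨by linarith, by nlinarith⟩

end Constants

theorem mainTheorem6 :
    (∀ r ∈ Set.Ioo (0 : ℝ) 1,
      IsLeast (sinRatioValues r) (gammaTilde r) ∧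
      (∀ (H : Type u) [NormedAddCommGroup H] [InnerProductSpace ℂ H] [CompleteSpace H]
        (A B X : H →L[ℂ] H), 0 ≤ A → 0 ≤ B →
          ‖A ^ r * X - X * B ^ r‖ ≤
            gammaTilde r * ‖X‖ ^ (1 - r) * ‖A * X - X * B‖ ^ r) ∧
      IsLeast (commutatorConstants.{u} r) (gammaZero.{u} r) ∧
      gammaZero.{u} r ≤ gammaTilde r) ∧
    gammaZero.{u} (1 / 2) ≤ 1.1748 := by
  have hle : ∀ r ∈ Set.Ioo (0 : ℝ) 1, gammaZero.{u} r ≤ gammaTilde r := fun r hr =>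
    (gammaZero_isLeast hr).2 (gammaTilde_mem_commutatorConstants hr)
  exact ⟨fun r hr => ⟨gammaTilde_isLeast hr,
    fun H _ _ _ A B X hA hB => norm_rpow_mul_sub_mul_rpow_le_gammaTilde hr X hA hB,
    gammaZero_isLeast hr, hle r hr⟩,
    (hle _ (by norm_num)).trans gammaTilde_half_le⟩
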